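/- **Proposition 3.3.** By a monoid we mean a commutative cancellative semigroup with identity. For a monoid $H$ let $H^\times$ be its group of units, $H_{\mathrm{red}}=H/H^\times$, and let $\mathsf L(a)\subset\mathbb N_0$ be the set of lengths of $a\in H$, i.e. the set of all $k$ such that $aH^\times$ is a product of $k$ atoms (irreducible elements) of $H_{\mathrm{red}}$ (so $\mathsf L(a)=\{0\}$ if $a$ is a unit). Put $\mathcal L(H)=\{\mathsf L(a): a\in H\}$. For sets of integers, $L+L'=\{l+l' : l\in L,\ l'\in L'\}$, and $\mathcal L(H)$ is called additively closed if $L+L'\in\mathcal L(H)$ for all $L,L'\in\mathcal L(H)$. A monoid is atomic if every non-unit is a finite product of atoms. For a subset $G_0$ of an additive abelian group, $\mathcal B(G_0)$ is the monoid of zero-sum sequences over $G_0$, i.e. the submonoid of the free abelian monoid on $G_0$ consisting of all $g_1\cdots g_\ell$ with $g_1+\dots+g_\ell=0$. A transfer homomorphism $\theta\colon H\to B$ is a monoid homomorphism between atomic monoids such that $B=\theta(H)B^\times$, $\theta^{-1}(B^\times)=H^\times$, and whenever $\theta(u)=bc$ with $u\in H$ and $b,c\in B$, there are $v,w\in H$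 with $u=vw$, $\theta(v)\in bB^\times$ and $\theta(w)\in cB^\times$. Let $H$ be a monoid. 1. If $H_{\mathrm{red}}$ is finitely generated, then there exist $m\in\mathbb N_0$ and $a_1^*,\dots,a_m^*\in H\setminus H^\times$ such that for every $a\in H\setminus H^\times$ there is $i\in[1,m]$ such that $a_i^*\mid a$ and $\mathsf L(a)=\mathsf L(a_i^*)+\mathsf L\big((a_i^*)^{-1}a\big)$. 2. Let $\theta\colon H\to\mathcal B(G_0)$ be a transfer homomorphism, where $G_0$ is a finite subset of an abelian group. Then there exist $m\in\mathbb N_0$ and $a_1^*,\dots,a_m^*\in H\setminus H^\times$ such that for every $a\in H\setminus H^\times$ there are $i\in[1,m]$ and $a_i'\in H$ with $a_i'\mid a$, $\theta(a_i')=\theta(a_i^*)$, and $\mathsf L(a)=\mathsf L(a_i^*)+\mathsf L\big((a_i')^{-1}a\big)$. Moreover, in the situation of 1. as well as of 2., if $\mathcal L(H)$ is additively closed, then $\mathcal L(H)$ is a finitely generated semigroup (under set addition, with identity element $\{0\}$). -/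

import Mathlib

open scoped Pointwise

/-!
Throughout, the reduced monoid `H_red = H/Hˣ` of a commutative monoid `H` is Mathlib's
`Associates H`, and the free abelian monoid with basis `P` is `Multiset P`.
-/

/-- The set of atoms `𝓐(H_red)` of the reduced monoid of `H`. -/
def RedAtom (H : Type*) [CommMonoid H] : Set (Associates H) := {p | Irreducible p}

/-- The factorization homomorphism `π : 𝖹(H) = 𝓕(𝓐(H_red)) → H_red`. -/
def factorizationMap (H : Type*) [CommMonoid H] (z : Multiset (RedAtom H)) : Associates H :=
  (z.map Subtype.val).prod

/-- A monoid is atomic if the factorization homomorphism is surjective. -/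
def IsAtomicMonoid (H : Type*) [CommMonoid H] : Prop :=
  Function.Surjective (factorizationMap H)

/-- The set of factorizations `𝖹(a) = π⁻¹(aHˣ)`. -/
def factorizationSet {H : Type*} [CommMonoid H] (a : H) : Set (Multiset (RedAtom H)) :=
  {z | factorizationMap H z = Associates.mk a}

/-- The set of lengths `𝖫(a) = {|z| : z ∈ 𝖹(a)}`. -/
def lengthSet {H : Type*} [CommMonoid H] (a : H) : Set ℕ :=
  Multiset.card '' factorizationSet a

/-- The system of sets of lengths `𝓛(H) = {𝖫(a) : a ∈ H}`. -/
def lengthSystem (H : Type*) [CommMonoid H] : Set (Set ℕ) :=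
  {L | ∃ a : H, L = lengthSet a}

/-- A family of sets of non-negative integers is additively closed if it is closed under sumsets. -/
def IsAdditivelyClosed (𝓛 : Set (Set ℕ)) : Prop :=
  ∀ L₁ ∈ 𝓛, ∀ L₂ ∈ 𝓛, L₁ + L₂ ∈ 𝓛

/-- The family `𝓛` is a semigroup under set addition with identity element `{0}`,
and it is finitely generated. -/
def IsFinitelyGeneratedSemigroup (𝓛 : Set (Set ℕ)) : Prop :=
  ∃ S : AddSubmonoid (Set ℕ), (S : Set (Set ℕ)) = 𝓛 ∧ S.FG

/-- A transfer homomorphism between atomic monoids. -/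
structure IsTransferHom {H B : Type*} [CommMonoid H] [CommMonoid B] (θ : H →* B) : Prop where
  atomic_source : IsAtomicMonoid H
  atomic_target : IsAtomicMonoid B
  /-- `B = θ(H) Bˣ` -/
  surj : ∀ b : B, ∃ (a : H) (u : Bˣ), b = θ a * u
  /-- `θ⁻¹(Bˣ) = Hˣ` -/
  isUnit_iff : ∀ a : H, IsUnit (θ a) ↔ IsUnit a
  /-- if `θ(u) = bc`, then `u = vw` with `θ(v) ∈ bBˣ` and `θ(w) ∈ cBˣ` -/
  lift : ∀ (u : H) (b c : B), θ u = b * c →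
    ∃ v w : H, u = v * w ∧ (∃ ε : Bˣ, θ v = b * ε) ∧ (∃ η : Bˣ, θ w = c * η)

/-- The monoid `𝓑(G₀)` of zero-sum sequences over `G₀`: those `S = g₁ ⋯ g_ℓ` in the free abelian
monoid `𝓕(G₀)` (written multiplicatively) with `σ(S) = g₁ + ⋯ + g_ℓ = 0`. -/
def zeroSumMonoid {G : Type*} [AddCommGroup G] (G₀ : Set G) :
    Submonoid (Multiplicative (Multiset G₀)) where
  carrier := {S | (S.toAdd.map Subtype.val).sum = 0}
  one_mem' := by simp
  mul_mem' := by
    intro S T hS hT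
    simp only [Set.mem_ofPred_eq] at hS hT ⊢
    simp [toAdd_mul, hS, hT]

/-! Let `H_red` be finitely generated. It suffices that every sequence `f` in `H` has `m < n` such
that `f m` divides `f n` and the length sets add: then repeatedly picking a non-unit not served by
its predecessors must stop. Factorizations form a free monoid on finitely many atoms, so Dickson's
lemma applies to them. Pairs of factorizations of the same element form a finitely generated monoid;
hence there are uniform `K` and `s` such that, in each residue class mod `K`, the lengths of an
element have gaps only within `s` steps of `K` from the top (`exists_uniform_exchange`). So finitely
many sample factorizations per element, the shortest and some near the longest in each class,
control its length set, and Dickson's lemma on all samples at once yields `m < n`. A transfer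
homomorphism preserves length sets, which reduces the second case to the finitely generated monoid
of zero-sum sequences. -/

/-- A multiset over `s` whose total weight is at least `(j + #s) K` has a part of weight exactly
`j K`, provided that all positive weights on `s` divide `K`. -/
lemma exists_le_sum_map_eq_mul {ι : Type*} [DecidableEq ι] (s : Finset ι) (g : ι → ℤ) {K : ℕ}
    (hK : 0 < K) (hg : ∀ i ∈ s, 0 < g i → g i ∣ K) (j : ℕ) (c : Multiset ι) (hc : ∀ i ∈ c, i ∈ s)
    (hj : ((j : ℤ) + s.card) * K ≤ (c.map g).sum) :
    ∃ c' ≤ c, (c'.map g).sum = j * K := by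
  induction j generalizing c with
  | zero => exact ⟨0, Multiset.zero_le _, by simp⟩
  | succ j ih =>
    -- Pigeonhole: some single `i` contributes at least `K`, so `K / g i` copies of it can be split
    -- off.
    obtain ⟨i, hi, hle⟩ : ∃ i ∈ s, (K : ℤ) ≤ c.count i * g i := by
      by_contra! h
      have hsum : (c.map g).sum = ∑ i ∈ s, (c.count i : ℤ) * g i := by
        rw [Finset.sum_multiset_map_count]
        simp only [nsmul_eq_mul]
        refine Finset.sum_subset (fun i hi => hc i (Multiset.mem_toFinset.1 hi)) fun i _ hi => ?_
        rw [Multiset.count_eq_zero_of_notMem (by simpa using hi)]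
        simp
      have hbound : ∑ i ∈ s, (c.count i : ℤ) * g i ≤ s.card * K := by
        simpa using Finset.sum_le_card_nsmul s _ (K : ℤ) fun i hi => (h i hi).le
      push_cast at hj
      have : (0 : ℤ) ≤ j * K := by positivity
      have : (0 : ℤ) < K := by exact_mod_cast hK
      nlinarith
    have hgi : 0 < g i := by
      by_contra! h0
      have : (c.count i : ℤ) * g i ≤ 0 := mul_nonpos_of_nonneg_of_nonpos (by positivity) h0
      omega
    obtain ⟨q, hq⟩ := hg i hi hgi
    have hq0 : 0 ≤ q := by
      by_contra! h0
      have : g i * q < 0 := mul_neg_of_pos_of_neg hgi h0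
      omega
    lift q to ℕ using hq0
    have hqc : q ≤ c.count i := by
      rw [hq, mul_comm] at hle
      exact_mod_cast le_of_mul_le_mul_right hle hgi
    obtain ⟨d, rfl⟩ := Multiset.le_iff_exists_add.1 (Multiset.le_count_iff_replicate_le.1 hqc)
    have hrep : ((Multiset.replicate q i).map g).sum = K := by
      simp [hq, mul_comm]
    rw [Multiset.map_add, Multiset.sum_add, hrep] at hj
    push_cast at hj
    obtain ⟨d', hd', hs⟩ := ih d (fun a ha => hc a (Multiset.mem_add.2 (Or.inr ha))) (by linarith)
    refine ⟨Multiset.replicate q i + d', by gcongr, ?_⟩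
    rw [Multiset.map_add, Multiset.sum_add, hrep, hs]
    push_cast
    ring

instance Multiset.wellQuasiOrderedLE {A : Type*} [Finite A] :
    WellQuasiOrderedLE (Multiset A) := by
  classical
  exact (Finsupp.orderIsoMultiset (ι := A)).wellQuasiOrderedLE_iff.1 inferInstance

/-! ### Sizes in the fibres of a homomorphism from a free monoid -/

section Fibres

variable {A N : Type*} [Finite A] [AddCommMonoid N] [IsCancelAdd N] (φ : Multiset A →+ N)

/-- The sizes of the multisets in a common fibre form arithmetic progressions with a uniform
difference, up to a bounded part at their ends. -/
lemma exists_uniform_exchange :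
    ∃ K s : ℕ, 0 < K ∧ ∀ x y, φ x = φ y → ∀ n j, y.card = x.card + n * K → j + s ≤ n →
      ∃ z, φ z = φ x ∧ z.card = x.card + j * K := by
  classical
  -- As `N` is cancellative, the pairs with equal image are closed under differences, so Dickson's
  -- lemma gives finitely many generators.
  obtain ⟨B, hB⟩ := AddSubmonoid.fg_eqLocusM (φ.comp (AddMonoidHom.fst (Multiset A) (Multiset A)))
    (φ.comp (AddMonoidHom.snd (Multiset A) (Multiset A)))
  have hBφ : ∀ p ∈ B, φ p.1 = φ p.2 := fun p hp => by
    have : p ∈ AddSubmonoid.closure (B : Set (Multiset A × Multiset A)) :=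
      AddSubmonoid.subset_closure hp
    rw [hB] at this
    simpa using this
  let g : Multiset A × Multiset A → ℤ := fun p => p.2.card - p.1.card
  let k : Multiset A × Multiset A → ℕ := fun p => if g p = 0 then 1 else (g p).natAbs
  have hk : ∀ p, 0 < k p := fun p => by
    simp only [k]; split_ifs <;> omega
  refine ⟨∏ p ∈ B, k p, B.card, Finset.prod_pos fun p _ => hk p, fun x y hxy n j hn hj => ?_⟩
  set K := ∏ p ∈ B, k p
  have hmem : (x, y) ∈ AddSubmonoid.closure (B : Set (Multiset A × Multiset A)) := by
    rw [hB]; simpa using hxy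
  obtain ⟨c, hc, hsum⟩ := AddSubmonoid.exists_multiset_of_mem_closure hmem
  have hfst : ∀ d : Multiset (Multiset A × Multiset A), d.sum.1 = (d.map Prod.fst).sum :=
    fun d => map_multiset_sum (AddMonoidHom.fst (Multiset A) (Multiset A)) d
  have hsnd : ∀ d : Multiset (Multiset A × Multiset A), d.sum.2 = (d.map Prod.snd).sum :=
    fun d => map_multiset_sum (AddMonoidHom.snd (Multiset A) (Multiset A)) d
  have hgsum : ∀ d : Multiset (Multiset A × Multiset A), (d.map g).sum = g d.sum := fun d => by
    induction d using Multiset.induction_on with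
    | empty => simp [g]
    | cons a d ih =>
      rw [Multiset.map_cons, Multiset.sum_cons, Multiset.sum_cons, ih]
      simp only [g, Prod.fst_add, Prod.snd_add, Multiset.card_add]
      push_cast
      ring
  have hφ : ∀ d : Multiset (Multiset A × Multiset A), (∀ p ∈ d, p ∈ B) → φ d.sum.1 = φ d.sum.2 :=
    fun d hd => by
      rw [hfst, hsnd, map_multiset_sum, map_multiset_sum, Multiset.map_map, Multiset.map_map]
      exact congrArg _ (Multiset.map_congr rfl fun p hp => hBφ p (hd p hp))
  -- Among the generators composing `(x, y)`, some have total gain exactly `j * K`; exchanging first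
  -- for second components in these alone turns `x` into `z`.
  obtain ⟨c', hc', hs'⟩ := exists_le_sum_map_eq_mul B g (K := K)
    (Finset.prod_pos fun p _ => hk p)
    (fun p hp h0 => by
      have : k p ∣ K := Finset.dvd_prod_of_mem _ hp
      rw [← Int.natCast_dvd_natCast] at this
      simpa [k, h0.ne', abs_of_pos h0] using this) j c hc (by
      rw [hgsum, hsum]
      simp only [g, hn, Nat.cast_add, Nat.cast_mul]
      have : ((j : ℤ) + B.card) ≤ n := by exact_mod_cast hj
      have := mul_le_mul_of_nonneg_right this (Int.natCast_nonneg K)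
      linarith)
  obtain ⟨d, rfl⟩ := Multiset.le_iff_exists_add.1 hc'
  rw [Multiset.sum_add] at hsum
  have hx : c'.sum.1 + d.sum.1 = x := congrArg Prod.fst hsum
  refine ⟨c'.sum.2 + d.sum.1, ?_, ?_⟩
  · rw [← hx, map_add, map_add, hφ c' fun p hp => hc p (Multiset.mem_add.2 (Or.inl hp))]
  · rw [hgsum] at hs'
    simp only [g] at hs'
    rw [← hx, Multiset.card_add, Multiset.card_add]
    zify
    linarith

omit [Finite A] [AddCommMonoid N] [IsCancelAdd N] in
/-- A simultaneous form of Dickson's lemma. -/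
lemma exists_lt_forall_exists_le [Finite A] {ι : Type*} [Finite ι] (F : ι → N → Set (Multiset A))
    (f : ℕ → N) :
    ∃ m n, m < n ∧ ∀ i, ((F i (f m)).Nonempty ↔ (F i (f n)).Nonempty) ∧
      ((F i (f n)).Nonempty → ∃ x ∈ F i (f m), ∃ y ∈ F i (f n), x ≤ y) := by
  classical
  -- Equality on the finite type `Set ι` is a well-quasi-order, so the pattern of nonempty sets is
  -- matched together with the representatives.
  let d : ℕ → Set ι × (ι → Multiset A) := fun n =>
    ({i | (F i (f n)).Nonempty}, fun i => if h : (F i (f n)).Nonempty then h.some else 0)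
  obtain ⟨m, n, hmn, h₁, h₂⟩ :=
    ((Finite.wellQuasiOrdered (α := Set ι) (· = ·)).prod
      (wellQuasiOrdered_le (α := ι → Multiset A))) d
  have hiff : ∀ i, (F i (f m)).Nonempty ↔ (F i (f n)).Nonempty := fun i => Set.ext_iff.1 h₁ i
  refine ⟨m, n, hmn, fun i => ⟨hiff i, fun hn => ?_⟩⟩
  have hm := (hiff i).2 hn
  refine ⟨hm.some, hm.some_mem, hn.some, hn.some_mem, ?_⟩
  simpa [d, hm, hn] using h₂ i

/-- The fibres of a surjection with trivial kernel onto a cancellative monoid, from the free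
monoid over a finite set, are well-quasi-ordered by divisibility with additive sets of sizes. -/
theorem exists_lt_card_image_fibre_eq_add (hker : ∀ z, φ z = 0 → z = 0)
    (hsurj : Function.Surjective φ) (f : ℕ → N) :
    ∃ m n, m < n ∧ ∃ h, f n = f m + h ∧
      Multiset.card '' {z | φ z = f n} =
        Multiset.card '' {z | φ z = f m} + Multiset.card '' {z | φ z = h} := by
  obtain ⟨K, s, hK, hex⟩ := exists_uniform_exchange φ
  have hfin : ∀ a, {z | φ z = a}.Finite := fun a =>
    WellQuasiOrderedLE.finite_of_isAntichain fun x hx y hy hne hle => hne <| by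
      obtain ⟨w, rfl⟩ := Multiset.le_iff_exists_add.1 hle
      have : φ x + φ w = φ x + 0 := by rw [← map_add, add_zero, hx, hy]
      rw [hker w (add_left_cancel this), add_zero]
  -- In residue class `r`: `none` collects the shortest elements, `some t` those exactly `t * K`
  -- below the maximum.
  let F : ℕ × Option ℕ → N → Set (Multiset A)
    | (r, none), a => {z | φ z = a ∧ z.card % K = r ∧
        ∀ w, φ w = a → w.card % K = r → z.card ≤ w.card}
    | (r, some t), a => {z | φ z = a ∧ z.card % K = r ∧ ∃ v, φ v = a ∧ v.card = z.card + t * K ∧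
        ∀ w, φ w = a → w.card % K = r → w.card ≤ v.card}
  obtain ⟨m, n, hmn, hF⟩ := exists_lt_forall_exists_le
    (fun i : Fin K × Option (Fin (2 * s + 1)) => F (i.1, i.2.map Fin.val)) f
  have hmin : ∀ r : Fin K, ∀ z, φ z = f n → z.card % K = r →
      ∃ x ∈ F (r, none) (f m), ∃ y ∈ F (r, none) (f n), x ≤ y := fun r z hz hr => by
    refine (hF (r, none)).2 ?_
    obtain ⟨y, ⟨hy, hyr⟩, hmin⟩ := Set.exists_min_image {z | φ z = f n ∧ z.card % K = r}
      Multiset.card ((hfin _).subset fun _ h => h.1) ⟨z, hz, hr⟩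
    exact ⟨y, hy, hyr, fun w hw hwr => hmin w ⟨hw, hwr⟩⟩
  have hmax : ∀ r : Fin K, ∀ z, φ z = f n → z.card % K = r →
      ∃ v, φ v = f n ∧ v.card % K = r ∧ ∀ w, φ w = f n → w.card % K = r → w.card ≤ v.card :=
    fun r z hz hr => by
      obtain ⟨y, ⟨hy, hyr⟩, hmax⟩ := Set.exists_max_image {z | φ z = f n ∧ z.card % K = r}
        Multiset.card ((hfin _).subset fun _ h => h.1) ⟨z, hz, hr⟩
      exact ⟨y, hy, hyr, fun w hw hwr => hmax w ⟨hw, hwr⟩⟩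
  have hend : ∀ (r : Fin K) (t : Fin (2 * s + 1)), (F (r, some t) (f n)).Nonempty →
      ∃ x ∈ F (r, some t) (f m), ∃ y ∈ F (r, some t) (f n), x ≤ y := fun r t => (hF (r, some t)).2
  obtain ⟨h, hh⟩ : ∃ h, f n = f m + h := by
    obtain ⟨z, hz⟩ := hsurj (f n)
    obtain ⟨x, ⟨hx, -⟩, y, ⟨hy, -⟩, hxy⟩ := hmin ⟨_, Nat.mod_lt _ hK⟩ z hz rfl
    obtain ⟨u, rfl⟩ := Multiset.le_iff_exists_add.1 hxy
    exact ⟨φ u, by rw [← hx, ← hy, map_add]⟩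
  have hdiff : ∀ x u, φ x = f m → φ (x + u) = f n → φ u = h := fun x u hx hu => by
    rw [map_add, hx, hh] at hu
    exact add_left_cancel hu
  have hstep : ∀ {a b : ℕ}, a ≤ b → a % K = b % K → ∃ t, b = a + t * K := fun {a b} hab hmod => by
    obtain ⟨t, ht⟩ := (Nat.modEq_iff_dvd' hab).1 hmod
    exact ⟨t, by rw [mul_comm]; omega⟩
  refine ⟨m, n, hmn, h, hh, Set.Subset.antisymm ?_ ?_⟩
  · rintro _ ⟨z, hz, rfl⟩
    obtain ⟨r, hr⟩ : ∃ r : Fin K, z.card % K = r := ⟨⟨_, Nat.mod_lt _ hK⟩, rfl⟩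
    obtain ⟨v, hv, hvr, hvmax⟩ := hmax r z hz hr
    obtain ⟨t, ht⟩ := hstep (hvmax z hz hr) (hr.trans hvr.symm)
    -- Near the top, a sample of the same size as `z` splits directly. Further down, sizes are built
    -- by exchanges in the two summands separately.
    by_cases hts : t < 2 * s + 1
    · obtain ⟨x, ⟨hx, -⟩, y, ⟨hy, hyr, w, hw, hwc, hwmax⟩, hxy⟩ :=
        hend r ⟨t, hts⟩ ⟨z, hz, hr, v, hv, ht, hvmax⟩
      obtain ⟨u, rfl⟩ := Multiset.le_iff_exists_add.1 hxy
      refine Set.mem_add.2 ⟨_, ⟨x, hx, rfl⟩, _, ⟨u, hdiff x u hx hy, rfl⟩, ?_⟩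
      have h1 := hwmax v hv hvr
      have h2 := hvmax w hw (by rw [hwc, Nat.add_mul_mod_self_right, hyr])
      have h3 : w.card = (x + u).card + t * K := hwc
      rw [Multiset.card_add] at h3
      omega
    · obtain ⟨x, ⟨hx, hxr, hxmin⟩, y, ⟨hy, hyr, hymin⟩, hxy⟩ := hmin r z hz hr
      obtain ⟨u, rfl⟩ := Multiset.le_iff_exists_add.1 hxy
      obtain ⟨x', ⟨hx', hxr', v₁, hv₁, hvc₁, hvmax₁⟩, y', ⟨hy', hyr', v₂, hv₂, hvc₂, hvmax₂⟩, hxy'⟩ :=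
        hend r ⟨0, by omega⟩ ⟨v, hv, hvr, v, hv, by simp, hvmax⟩
      obtain ⟨u', rfl⟩ := Multiset.le_iff_exists_add.1 hxy'
      have hu := hdiff x u hx hy
      have hu' := hdiff x' u' hx' hy'
      -- The mixed sum `x + u'` serves to derive `u.card ≤ u'.card` from the minimality of `x + u`.
      have hxu' : φ (x + u') = f n := by rw [map_add, hx, hu', hh]
      have hxur' : (x + u').card % K = r := by
        rw [← hyr', Multiset.card_add, Multiset.card_add]
        exact Nat.ModEq.add_right _ (hxr.trans hxr'.symm)
      obtain ⟨q, hq⟩ := hstep (hymin _ hxu' hxur') (hyr.trans hxur'.symm)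
      obtain ⟨j, hj⟩ := hstep (hymin z hz hr) (hyr.trans hr.symm)
      have hx'max := hvmax₁ x hx hxr
      simp only [zero_mul, add_zero] at hvc₁ hvc₂
      rw [hvc₁] at hx'max
      obtain ⟨p, hp⟩ := hstep hx'max (hxr.trans hxr'.symm)
      have hvy : v.card = (x' + u').card :=
        le_antisymm (hvc₂ ▸ hvmax₂ v hv hvr) (hvmax _ hy' hyr')
      simp only [Multiset.card_add] at hq hj hvy
      have hpq : j + t = p + q := by
        have : (j + t) * K = (p + q) * K := by rw [add_mul, add_mul]; omega
        exact Nat.eq_of_mul_eq_mul_right hK this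
      -- Since `j + 2 * s < p + q`, the `j` steps can be shared so that each nonzero share leaves
      -- the `s` spare steps needed for an exchange.
      obtain ⟨j₁, j₂, rfl, h₁, h₂⟩ :
          ∃ j₁ j₂, j = j₁ + j₂ ∧ (j₁ = 0 ∨ j₁ + s ≤ p) ∧ (j₂ = 0 ∨ j₂ + s ≤ q) :=
        ⟨min j (p - s), j - min j (p - s), by omega, by omega, by omega⟩
      obtain ⟨w₁, hw₁, hc₁⟩ : ∃ w, φ w = f m ∧ w.card = x.card + j₁ * K := by
        rcases h₁ with rfl | h₁
        · exact ⟨x, hx, by simp⟩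
        · simpa [hx] using hex x x' (hx.trans hx'.symm) p j₁ hp h₁
      obtain ⟨w₂, hw₂, hc₂⟩ : ∃ w, φ w = h ∧ w.card = u.card + j₂ * K := by
        rcases h₂ with rfl | h₂
        · exact ⟨u, hu, by simp⟩
        · simpa [hu] using hex u u' (hu.trans hu'.symm) q j₂ (by omega) h₂
      refine Set.mem_add.2 ⟨_, ⟨w₁, hw₁, rfl⟩, _, ⟨w₂, hw₂, rfl⟩, ?_⟩
      rw [add_mul] at hj
      omega
  · rintro _ ⟨_, ⟨x, hx, rfl⟩, _, ⟨u, hu, rfl⟩, rfl⟩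
    refine ⟨x + u, ?_, by simp⟩
    simp only [Set.mem_ofPred_eq] at hx hu ⊢
    rw [map_add, hx, hu, hh]

end Fibres

/-! ### Finitely generated reduced monoids -/

section Reduced

variable {H : Type*} [CommMonoid H]

instance Associates.instIsCancelMulOfCommMonoid [IsCancelMul H] : IsCancelMul (Associates H) :=
  have : IsLeftCancelMul (Associates H) := ⟨fun a b c h => by
    obtain ⟨a, rfl⟩ := Associates.mk_surjective a
    obtain ⟨b, rfl⟩ := Associates.mk_surjective b
    obtain ⟨c, rfl⟩ := Associates.mk_surjective c
    simp only [Associates.mk_mul_mk, Associates.mk_eq_mk_iff_associated] at h ⊢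
    obtain ⟨u, hu⟩ := h
    exact ⟨u, mul_left_cancel (a := a) (by rw [← hu, mul_assoc])⟩⟩
  CommMagma.IsLeftCancelMul.toIsCancelMul _

lemma Associates.irreducible_mk_iff {a : H} : Irreducible (Associates.mk a) ↔ Irreducible a := by
  simp only [irreducible_iff, Associates.isUnit_mk, Associates.forall_associated,
    Associates.mk_mul_mk, Associates.mk_eq_mk_iff_associated]
  refine and_congr_right fun _ => ⟨fun h x y hxy => h x y (hxy ▸ Associated.refl _), ?_⟩
  rintro h x y ⟨u, hu⟩
  have := @h x (y * ↑u⁻¹) (by rw [← mul_assoc, ← hu, Units.mul_inv_cancel_right])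
  simpa using this

lemma Monoid.FG.wellQuasiOrdered_dvd (hfg : Monoid.FG H) :
    WellQuasiOrdered ((· ∣ ·) : H → H → Prop) := by
  obtain ⟨S, hS⟩ := hfg.fg_top
  refine (wellQuasiOrdered_le (α := Multiset S)).of_surjective
    ⟨fun z => (z.map Subtype.val).prod, fun {x y} hxy => ?_⟩ fun a => ?_
  · exact Multiset.prod_dvd_prod_of_le (Multiset.map_le_map hxy)
  · obtain ⟨c, hc, rfl⟩ := Submonoid.exists_multiset_of_mem_closure
      (s := (S : Set H)) (x := a) (hS ▸ Submonoid.mem_top a)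
    lift c to Multiset S using hc
    exact ⟨c, rfl⟩

lemma factorizationMap_add (z w : Multiset (RedAtom H)) :
    factorizationMap H (z + w) = factorizationMap H z * factorizationMap H w := by
  simp [factorizationMap]

lemma eq_zero_of_factorizationMap_eq_one {z : Multiset (RedAtom H)}
    (hz : factorizationMap H z = 1) : z = 0 := by
  induction z using Multiset.induction_on with
  | empty => rfl
  | cons p z _ =>
    simp only [factorizationMap, Multiset.map_cons, Multiset.prod_cons] at hz
    exact absurd (IsUnit.of_mul_eq_one _ hz) p.2.not_isUnit

/-- In a reduced monoid an atom is no product of two non-identity elements, so it lies in every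
generating set. -/
lemma finite_redAtom_of_fg (hfg : Monoid.FG (Associates H)) : Finite (RedAtom H) := by
  obtain ⟨S, hS⟩ := hfg.fg_top
  refine (S.finite_toSet.subset fun p (hp : Irreducible p) => ?_).to_subtype
  have hmem : p ∈ Submonoid.closure (S : Set (Associates H)) := hS ▸ Submonoid.mem_top p
  revert hp
  induction hmem using Submonoid.closure_induction with
  | mem x hx => exact fun _ => hx
  | one => exact fun h => absurd h not_irreducible_one
  | mul x y _ _ hx hy =>
    intro h
    rcases h.isUnit_or_isUnit rfl with h1 | h1 <;>
      rw [Associates.isUnit_iff_eq_one] at h1 <;> subst h1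
    · rw [one_mul] at h ⊢; exact hy h
    · rw [mul_one] at h ⊢; exact hx h

lemma Associates.wellFounded_dvd_of_fg (hfg : Monoid.FG (Associates H)) :
    WellFounded fun a b : Associates H => a ∣ b ∧ ¬ b ∣ a :=
  have : IsPreorder (Associates H) (· ∣ ·) := { refl := dvd_refl, trans := fun _ _ _ => dvd_trans }
  hfg.wellQuasiOrdered_dvd.wellFounded

lemma Associates.not_mul_dvd_left [IsCancelMul H] {a b : Associates H} (hb : ¬ IsUnit b) :
    ¬ a * b ∣ a := by
  rintro ⟨c, hc⟩
  refine hb (IsUnit.of_mul_eq_one c (mul_left_cancel (a := a) ?_))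
  rw [← mul_assoc, ← hc, mul_one]

lemma isAtomicMonoid_of_fg [IsCancelMul H] (hfg : Monoid.FG (Associates H)) :
    IsAtomicMonoid H := by
  intro a
  induction a using (Associates.wellFounded_dvd_of_fg hfg).induction with
  | _ a ih =>
    by_cases h1 : IsUnit a
    · exact ⟨0, by simp [factorizationMap, (Associates.isUnit_iff_eq_one a).1 h1]⟩
    by_cases hirr : Irreducible a
    · exact ⟨{⟨a, hirr⟩}, by simp [factorizationMap]⟩
    · simp only [irreducible_iff, h1, not_false_eq_true, true_and] at hirr
      push Not at hirr
      obtain ⟨b, c, rfl, hb, hc⟩ := hirr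
      obtain ⟨z, rfl⟩ := ih b ⟨dvd_mul_right _ _, Associates.not_mul_dvd_left hc⟩
      obtain ⟨w, rfl⟩ := ih c ⟨dvd_mul_left _ _, mul_comm c _ ▸ Associates.not_mul_dvd_left hb⟩
      exact ⟨z + w, factorizationMap_add z w⟩

/-- For a finitely generated reduced monoid, divisibility with additive sets of lengths is a
well-quasi-order. -/
theorem exists_lt_lengthSet_eq_add [IsCancelMul H] (hfg : Monoid.FG (Associates H)) (f : ℕ → H) :
    ∃ m n, m < n ∧ ∃ c, f n = f m * c ∧
      lengthSet (f n) = lengthSet (f m) + lengthSet c := by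
  have := finite_redAtom_of_fg hfg
  let φ : Multiset (RedAtom H) →+ Additive (Associates H) :=
    { toFun := fun z => Additive.ofMul (factorizationMap H z)
      map_zero' := by simp [factorizationMap]
      map_add' := fun z w => by rw [factorizationMap_add]; rfl }
  obtain ⟨m, n, hmn, h, hh, hL⟩ := exists_lt_card_image_fibre_eq_add φ
    (fun z hz => eq_zero_of_factorizationMap_eq_one hz) (isAtomicMonoid_of_fg hfg)
    (fun n => Additive.ofMul (Associates.mk (f n)))
  obtain ⟨c, hc⟩ := Associates.mk_surjective h.toMul
  have hassoc : Associates.mk (f m * c) = Associates.mk (f n) := by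
    rw [← Associates.mk_mul_mk, hc]; exact hh.symm
  obtain ⟨u, hu⟩ := Associates.mk_eq_mk_iff_associated.1 hassoc
  have hcu : Associates.mk (c * u) = h.toMul := by
    rw [← hc, Associates.mk_eq_mk_iff_associated]
    exact Associated.symm ⟨u, rfl⟩
  refine ⟨m, n, hmn, c * u, by rw [← mul_assoc, hu], ?_⟩
  rw [lengthSet, lengthSet, lengthSet, factorizationSet, factorizationSet, factorizationSet, hcu]
  exact hL

theorem exists_finset_lengthSet_eq_add [IsCancelMul H] (hfg : Monoid.FG (Associates H)) :
    ∃ T : Finset H, (∀ t ∈ T, ¬ IsUnit t) ∧ ∀ a : H, ¬ IsUnit a →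
      ∃ t ∈ T, ∃ c, a = t * c ∧ lengthSet a = lengthSet t + lengthSet c := by
  by_contra! hcon
  -- If no finite set works, this builds a sequence in which no term serves a later one.
  obtain ⟨f, -, hf⟩ := exists_seq_of_forall_finset_exists (fun a : H => ¬ IsUnit a)
    (fun t a => ∀ c, a = t * c → lengthSet a ≠ lengthSet t + lengthSet c) hcon
  obtain ⟨m, n, hmn, c, hc, hL⟩ := exists_lt_lengthSet_eq_add hfg f
  exact hf m n hmn c hc hL

lemma lengthSet_of_isUnit {a : H} (ha : IsUnit a) : lengthSet a = 0 := by
  have h1 : Associates.mk a = 1 := Associates.mk_eq_one.2 ha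
  ext k
  simp only [lengthSet, factorizationSet, h1, Set.mem_image, Set.mem_ofPred_eq, Set.mem_zero]
  constructor
  · rintro ⟨z, hz, rfl⟩
    rw [eq_zero_of_factorizationMap_eq_one hz, Multiset.card_zero]
  · rintro rfl
    exact ⟨0, by simp [factorizationMap], rfl⟩

/-- Splitting off members of the finite set repeatedly terminates because strict divisibility is
well-founded, so their length sets generate. -/
theorem isFinitelyGeneratedSemigroup_lengthSystem [IsCancelMul H]
    (hfg : Monoid.FG (Associates H)) (hadd : IsAdditivelyClosed (lengthSystem H)) :
    IsFinitelyGeneratedSemigroup (lengthSystem H) := by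
  classical
  obtain ⟨T, hT, hL⟩ := exists_finset_lengthSet_eq_add hfg
  refine ⟨⟨⟨lengthSystem H, fun {a b} ha hb => hadd a ha b hb⟩,
    ⟨1, (lengthSet_of_isUnit isUnit_one).symm⟩⟩, rfl, T.image lengthSet, le_antisymm ?_ ?_⟩
  · rw [AddSubmonoid.closure_le]
    intro L hL
    obtain ⟨a, -, rfl⟩ := Finset.mem_image.1 (Finset.mem_coe.1 hL)
    exact ⟨a, rfl⟩
  · rintro _ ⟨a, rfl⟩
    induction a using (InvImage.wf Associates.mk
      (Associates.wellFounded_dvd_of_fg hfg)).induction with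
    | _ a ih =>
      by_cases ha : IsUnit a
      · rw [lengthSet_of_isUnit ha]; exact zero_mem _
      obtain ⟨t, ht, c, rfl, hs⟩ := hL a ha
      rw [hs]
      refine add_mem (AddSubmonoid.subset_closure ?_) (ih c ⟨?_, ?_⟩)
      · exact Finset.mem_coe.2 (Finset.mem_image_of_mem _ ht)
      · exact Associates.mk_dvd_mk.2 (dvd_mul_left _ _)
      · rw [mul_comm, ← Associates.mk_mul_mk]
        exact Associates.not_mul_dvd_left (mt Associates.isUnit_mk.1 (hT t ht))

/-- Atoms of `H` itself, with products up to associates, are what a transfer homomorphism can lift.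
-/
lemma mem_lengthSet_iff {a : H} {k : ℕ} :
    k ∈ lengthSet a ↔
      ∃ z : Multiset H, (∀ x ∈ z, Irreducible x) ∧ z.card = k ∧ Associated z.prod a := by
  have hmk : ∀ z : Multiset H, (z.map Associates.mk).prod = Associates.mk z.prod := fun z =>
    (map_multiset_prod Associates.mkMonoidHom z).symm
  constructor
  · rintro ⟨z, hz, rfl⟩
    refine ⟨z.map fun p => Quotient.out p.1, fun x hx => ?_, Multiset.card_map _ _, ?_⟩
    · obtain ⟨p, -, rfl⟩ := Multiset.mem_map.1 hx
      rw [← Associates.irreducible_mk_iff, Associates.mk, Quotient.out_eq]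
      exact p.2
    · rw [← Associates.mk_eq_mk_iff_associated, ← hmk, Multiset.map_map, ← hz, factorizationMap]
      exact congrArg _ (Multiset.map_congr rfl fun p _ => Quotient.out_eq p.1)
  · rintro ⟨z, hz, rfl, ha⟩
    have hz' : ∀ p ∈ z.map Associates.mk, p ∈ RedAtom H := fun p hp => by
      obtain ⟨x, hx, rfl⟩ := Multiset.mem_map.1 hp
      exact Associates.irreducible_mk_iff.2 (hz x hx)
    obtain ⟨w, hw⟩ : ∃ w : Multiset (RedAtom H), w.map Subtype.val = z.map Associates.mk := by
      generalize z.map Associates.mk = y at hz'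
      lift y to Multiset (RedAtom H) using hz'
      exact ⟨y, rfl⟩
    refine ⟨w, ?_, ?_⟩
    · simp only [factorizationSet, Set.mem_ofPred_eq, factorizationMap, hw, hmk]
      exact Associates.mk_eq_mk_iff_associated.2 ha
    · simpa using congrArg Multiset.card hw

end Reduced

/-! ### Transfer homomorphisms -/

section Transfer

variable {H B : Type*} [CommMonoid H] [CommMonoid B] {θ : H →* B}

lemma IsTransferHom.irreducible_iff (hθ : IsTransferHom θ) {a : H} :
    Irreducible (θ a) ↔ Irreducible a := by
  rw [_root_.irreducible_iff, _root_.irreducible_iff, hθ.isUnit_iff]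
  refine and_congr_right fun _ => ⟨fun h x y hxy => ?_, fun h b c hbc => ?_⟩
  · exact (h (hxy ▸ map_mul θ x y)).imp (hθ.isUnit_iff x).1 (hθ.isUnit_iff y).1
  · obtain ⟨v, w, hvw, ⟨ε, hv⟩, ⟨η, hw⟩⟩ := hθ.lift a b c hbc
    simpa [← hθ.isUnit_iff, hv, hw] using h hvw

/-- Transfer homomorphisms preserve sets of lengths. -/
theorem IsTransferHom.lengthSet_map (hθ : IsTransferHom θ) (a : H) :
    lengthSet (θ a) = lengthSet a := by
  ext k
  rw [mem_lengthSet_iff, mem_lengthSet_iff]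
  constructor
  · rintro ⟨z, hz, rfl, ha⟩
    induction z using Multiset.induction_on generalizing a with
    | empty =>
      refine ⟨0, by simp, rfl, ?_⟩
      rw [Multiset.prod_zero] at ha ⊢
      exact (associated_one_iff_isUnit.2
        ((hθ.isUnit_iff a).1 (associated_one_iff_isUnit.1 ha.symm))).symm
    | cons b z ih =>
      obtain ⟨u, hu⟩ := ha
      rw [Multiset.prod_cons, mul_assoc] at hu
      obtain ⟨v, w, rfl, ⟨ε, hv⟩, ⟨η, hw⟩⟩ := hθ.lift a _ _ hu.symm
      obtain ⟨y, hy, hcard, hprod⟩ := ih w (fun x hx => hz x (Multiset.mem_cons_of_mem hx))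
        ⟨u * η, by rw [hw, Units.val_mul, mul_assoc]⟩
      refine ⟨v ::ₘ y, fun x hx => ?_, by simp [hcard], ?_⟩
      · rcases Multiset.mem_cons.1 hx with rfl | hx
        · rw [← hθ.irreducible_iff, hv, irreducible_mul_units]
          exact hz b (Multiset.mem_cons_self _ _)
        · exact hy x hx
      · rw [Multiset.prod_cons]
        exact hprod.mul_left v
  · rintro ⟨z, hz, rfl, ha⟩
    refine ⟨z.map θ, fun x hx => ?_, Multiset.card_map _ _, ?_⟩
    · obtain ⟨p, hp, rfl⟩ := Multiset.mem_map.1 hx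
      exact hθ.irreducible_iff.2 (hz p hp)
    · rw [← map_multiset_prod]
      exact ha.map θ

lemma IsTransferHom.lengthSystem_eq (hθ : IsTransferHom θ) : lengthSystem H = lengthSystem B := by
  ext L
  constructor
  · rintro ⟨a, rfl⟩
    exact ⟨θ a, (hθ.lengthSet_map a).symm⟩
  · rintro ⟨b, rfl⟩
    obtain ⟨a, u, rfl⟩ := hθ.surj b
    refine ⟨a, ?_⟩
    rw [← hθ.lengthSet_map, lengthSet, lengthSet, factorizationSet, factorizationSet,
      Associates.mk_eq_mk_iff_associated.2 (associated_mul_unit_left (θ a) u u.isUnit)]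

end Transfer

/-! ### Zero-sum sequences -/

section ZeroSum

variable {G : Type*} [AddCommGroup G] (G₀ : Set G)

instance : Subsingleton (zeroSumMonoid G₀)ˣ where
  allEq u v := by
    have h : ∀ w : (zeroSumMonoid G₀)ˣ, w = 1 := fun w => by
      have hw : w.1.1.toAdd + w.2.1.toAdd = 0 :=
        congrArg (fun S : zeroSumMonoid G₀ => S.1.toAdd) w.val_inv
      exact Units.ext (Subtype.ext (add_eq_zero.1 hw).1)
    rw [h u, h v]

/-- If `S` and `S * T` have sum zero, so has `T`; by Dickson's lemma such submonoids are finitely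
generated. -/
lemma zeroSumMonoid_fg [Finite G₀] : Monoid.FG (zeroSumMonoid G₀) := by
  have : WellQuasiOrderedLE (Multiplicative (Multiset G₀)) :=
    ⟨wellQuasiOrdered_le (α := Multiset G₀)⟩
  rw [Monoid.fg_iff_submonoid_fg]
  refine Submonoid.fg_of_divisive fun S hS T hST => ?_
  change (S.toAdd.map Subtype.val).sum = 0 at hS
  change ((S.toAdd + T.toAdd).map Subtype.val).sum = 0 at hST
  rwa [Multiset.map_add, Multiset.sum_add, hS, zero_add] at hST

end ZeroSum

theorem proposition3p3 (H : Type*) [CancelCommMonoid H] :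
    -- the finitely generated case
    (Monoid.FG (Associates H) →
      (∃ (m : ℕ) (s : Fin m → H), (∀ i, ¬ IsUnit (s i)) ∧
        ∀ a : H, ¬ IsUnit a → ∃ (i : Fin m) (c : H), a = s i * c ∧
          lengthSet a = lengthSet (s i) + lengthSet c) ∧
      (IsAdditivelyClosed (lengthSystem H) → IsFinitelyGeneratedSemigroup (lengthSystem H))) ∧
    -- the case of a transfer homomorphism to the zero-sum sequences over a finite set
    (∀ (G : Type*) [AddCommGroup G] (G₀ : Set G), G₀.Finite →
      ∀ θ : H →* zeroSumMonoid G₀, IsTransferHom θ →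
      (∃ (m : ℕ) (s : Fin m → H), (∀ i, ¬ IsUnit (s i)) ∧
        ∀ a : H, ¬ IsUnit a → ∃ (i : Fin m) (a' c : H), a = a' * c ∧ θ a' = θ (s i) ∧
          lengthSet a = lengthSet (s i) + lengthSet c) ∧
      (IsAdditivelyClosed (lengthSystem H) → IsFinitelyGeneratedSemigroup (lengthSystem H))) := by
  refine ⟨fun hfg => ⟨?_, isFinitelyGeneratedSemigroup_lengthSystem hfg⟩,
    fun G _ G₀ hG₀ θ hθ => ?_⟩
  · obtain ⟨T, hT, hL⟩ := exists_finset_lengthSet_eq_add hfg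
    refine ⟨T.card, fun i => T.equivFin.symm i, fun i => hT _ (T.equivFin.symm i).2,
      fun a ha => ?_⟩
    obtain ⟨t, ht, c, hac, hs⟩ := hL a ha
    exact ⟨T.equivFin ⟨t, ht⟩, c, by simpa using hac, by simpa using hs⟩
  · have := hG₀.to_subtype
    have hfg : Monoid.FG (Associates (zeroSumMonoid G₀)) :=
      have := zeroSumMonoid_fg G₀
      Monoid.fg_of_surjective Associates.mkMonoidHom Associates.mk_surjective
    refine ⟨?_, fun hadd => ?_⟩
    · obtain ⟨T, hT, hL⟩ := exists_finset_lengthSet_eq_add hfg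
      -- Zero-sum sequences have only the trivial unit, so `θ` is surjective and its lifts hit `t`
      -- and `c` exactly.
      have hsurj : Function.Surjective θ := fun b => by
        obtain ⟨a, u, rfl⟩ := hθ.surj b
        exact ⟨a, by simp [Subsingleton.elim u 1]⟩
      choose σ hσ using hsurj
      refine ⟨T.card, fun i => σ (T.equivFin.symm i), fun i => ?_, fun a ha => ?_⟩
      · rw [← hθ.isUnit_iff, hσ]
        exact hT _ (T.equivFin.symm i).2
      · obtain ⟨t, ht, c, hac, hs⟩ := hL (θ a) (mt (hθ.isUnit_iff a).1 ha)
        obtain ⟨v, w, rfl, ⟨ε, hv⟩, ⟨η, hw⟩⟩ := hθ.lift a t c hac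
        rw [Subsingleton.elim ε 1, Units.val_one, mul_one] at hv
        rw [Subsingleton.elim η 1, Units.val_one, mul_one] at hw
        refine ⟨T.equivFin ⟨t, ht⟩, v, w, rfl, by simp [hσ, hv], ?_⟩
        rw [← hθ.lengthSet_map, hs, ← hθ.lengthSet_map (σ _), hσ, ← hθ.lengthSet_map w, hw]
        simp
    · rw [hθ.lengthSystem_eq] at hadd ⊢
      exact isFinitelyGeneratedSemigroup_lengthSystem hfg hadd
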